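/- For $0<q<1$ and $x>0$ let $\Gamma_q(x)=(1-q)^{1-x}\prod_{n=0}^{\infty}\frac{1-q^{n+1}}{1-q^{n+x}}$ be the $q$-gamma function, and let $\Gamma_1=\Gamma$. Let $\psi_q(x)=\Gamma_q'(x)/\Gamma_q(x)$ be the $q$-digamma function. Let $q\in(0,1]$. Then $\psi_q$ has exactly one zero $x_q$ in $(0,\infty)$, it satisfies $1<x_q<\frac32$, and each of the functions $$G_q(x)=\frac{\psi_q'(x)}{\psi_q(x)},\qquad \varphi_q(x)=x\,\frac{\psi_q'(x)}{\psi_q(x)},$$ defined on $(1,\infty)\setminus\{x_q\}$, is strictly decreasing on each of the two intervals $(1,x_q)$ and $(x_q,\infty)$. -/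

import Mathlib

open Set

/-- The `q`-gamma function `Γ_q(x)` for `q > 0` and `x > 0`, with the classical
`Γ_1 = Γ` at `q = 1`. -/
noncomputable def qGamma (q x : ℝ) : ℝ :=
  if q < 1 then
    (1 - q) ^ (1 - x) * ∏' n : ℕ, (1 - q ^ (n + 1)) / (1 - q ^ ((n : ℝ) + x))
  else if q = 1 then
    Real.Gamma x
  else
    (q - 1) ^ (1 - x) * q ^ (x * (x - 1) / 2) *
      ∏' n : ℕ, (1 - q ^ (-((n : ℝ) + 1))) / (1 - q ^ (-((n : ℝ) + x)))

/-- The `q`-digamma function `ψ_q(x) = Γ_q'(x) / Γ_q(x)`. -/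
noncomputable def qDigamma (q x : ℝ) : ℝ :=
  deriv (qGamma q) x / qGamma q x

open Filter Topology

/-!
For `0 < q ≤ 1` the `q`-gamma function is the exponential of the series
`∑ (x - 1) (L (n + 2) - L (n + 1)) + L (n + 1) - L (n + x)`, where
`L y = log ((1 - q ^ y) / (1 - q))` if `q < 1` and `L y = log y` if `q = 1`. Writing `ℓ = L'`,
`h = -ℓ'`, `k = -h'` (three positive functions), this gives

* `ψ x = ∑ L (n + 2) - L (n + 1) - ℓ (n + x)`,
* `ψ' x = ∑ h (n + x) > 0`,
* `ψ'' x = -∑ k (n + x) < 0`.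

The whole argument is carried out once, for a quadruple `L, ℓ, h, k` with the properties collected
in `IsGammaKernel`.

*Zero.* Every term of `ψ 1` is negative because `ℓ` decreases, and every term of `ψ (3 / 2)` is
positive because the midpoint rule underestimates the integral of the convex function `ℓ`
(`IsGammaKernel.ℓ_lt_sub`). As `ψ` is strictly increasing, its only zero `xq` lies in `(1, 3 / 2)`.

*Right of the zero.* There `ψ` is positive and increasing, so it suffices that `ψ'` and `x * ψ' x`
decrease. The derivative of the latter is `∑ h (n + x) - x * k (n + x)`. Since
`2 * h y ≤ y * k y`, the weight `y ^ 2 * h y` is antitone, and comparing it with its value at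
`y = 2 * x` bounds the sum by a positive multiple of `∑ (y - 2 * x) / y ^ 3` over `y = n + x`, which
is negative for `x > 1` (`tsum_sub_two_mul_div_cube_neg`).

*Left of the zero.* `ψ' / ψ` decreases if `-ψ * (-ψ'') < ψ' ^ 2`. Since `x + 1 / 2 > xq`, one has
`-ψ x < ψ (x + 1 / 2) - ψ x`, and the termwise bounds `ℓ y - ℓ (y + 1 / 2) ≤ a * h y` and
`k y ≤ b * h y` with `a * b ≤ 1` give the inequality
(`IsGammaKernel.digammaSeries_increment_mul_le`). As `ψ' / ψ` is negative there, `x * (ψ' x / ψ x)`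
decreases as well.
-/

/-! ### Monotonicity of `ψ' / ψ` from differential inequalities -/

/-- Left of the zero, `hkey` makes `D₁ / ψ` decrease because `ψ (x + 1 / 2)` is already positive;
right of it, `hmul` makes `x * D₁ x` decrease while `ψ` is positive and increasing. -/
theorem exists_zero_and_strictAntiOn {ψ D₁ D₂ : ℝ → ℝ}
    (hψ : ∀ x, 0 < x → HasDerivAt ψ (D₁ x) x)
    (hD₁ : ∀ x, 0 < x → HasDerivAt D₁ (D₂ x) x)
    (hpos : ∀ x, 0 < x → 0 < D₁ x) (hneg : ∀ x, 0 < x → D₂ x < 0)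
    (hmul : ∀ x, 1 < x → D₁ x + x * D₂ x < 0)
    (h1 : ψ 1 < 0) (h32 : 0 < ψ (3 / 2))
    (hkey : ∀ x, 1 < x → (ψ (x + 1 / 2) - ψ x) * (-D₂ x) ≤ D₁ x ^ 2) :
    ∃ xq ∈ Ioo (1 : ℝ) (3 / 2),
      (∀ x : ℝ, 0 < x → (ψ x = 0 ↔ x = xq)) ∧
      StrictAntiOn (fun x : ℝ => D₁ x / ψ x) (Ioo 1 xq) ∧
      StrictAntiOn (fun x : ℝ => D₁ x / ψ x) (Ioi xq) ∧
      StrictAntiOn (fun x : ℝ => x * (D₁ x / ψ x)) (Ioo 1 xq) ∧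
      StrictAntiOn (fun x : ℝ => x * (D₁ x / ψ x)) (Ioi xq) := by
  have hmono : StrictMonoOn ψ (Ioi 0) := by
    refine strictMonoOn_of_deriv_pos (convex_Ioi 0)
      (fun x hx => (hψ x hx).continuousAt.continuousWithinAt) fun x hx => ?_
    rw [interior_Ioi] at hx
    rw [(hψ x hx).deriv]
    exact hpos x hx
  have hanti : StrictAntiOn D₁ (Ioi 0) := by
    refine strictAntiOn_of_deriv_neg (convex_Ioi 0)
      (fun x hx => (hD₁ x hx).continuousAt.continuousWithinAt) fun x hx => ?_
    rw [interior_Ioi] at hx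
    rw [(hD₁ x hx).deriv]
    exact hneg x hx
  have hxanti : StrictAntiOn (fun x => x * D₁ x) (Ioi 1) := by
    have hd : ∀ x : ℝ, 1 < x → HasDerivAt (fun x => x * D₁ x) (D₁ x + x * D₂ x) x := fun x hx => by
      simpa using (hasDerivAt_id x).fun_mul (hD₁ x (by linarith))
    refine strictAntiOn_of_deriv_neg (convex_Ioi 1)
      (fun x hx => (hd x hx).continuousAt.continuousWithinAt) fun x hx => ?_
    rw [interior_Ioi] at hx
    rw [(hd x hx).deriv]
    exact hmul x hx
  obtain ⟨xq, hxq, hzero⟩ : ∃ xq ∈ Ioo (1 : ℝ) (3 / 2), ψ xq = 0 := by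
    have hc : ContinuousOn ψ (Icc 1 (3 / 2)) := fun x hx =>
      (hψ x (by linarith [hx.1])).continuousAt.continuousWithinAt
    exact intermediate_value_Ioo (by norm_num) hc ⟨h1, h32⟩
  obtain ⟨hq1, hq2⟩ := hxq
  have hq0 : xq ∈ Ioi (0 : ℝ) := by simp only [mem_Ioi]; linarith
  have hψneg : ∀ x ∈ Ioo 1 xq, ψ x < 0 := fun x hx => by
    rw [← hzero]
    exact hmono (by simp only [mem_Ioi]; linarith [hx.1]) hq0 hx.2
  have hψpos : ∀ x ∈ Ioi xq, 0 < ψ x := fun x hx => by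
    rw [← hzero]
    exact hmono hq0 (lt_trans (mem_Ioi.1 hq0) hx) hx
  have hleft : StrictAntiOn (fun x : ℝ => D₁ x / ψ x) (Ioo 1 xq) := by
    have hd : ∀ x ∈ Ioo 1 xq, HasDerivAt (fun x => D₁ x / ψ x)
        ((D₂ x * ψ x - D₁ x * D₁ x) / ψ x ^ 2) x := fun x hx =>
      (hD₁ x (by linarith [hx.1])).div (hψ x (by linarith [hx.1])) (hψneg x hx).ne
    refine strictAntiOn_of_deriv_neg (convex_Ioo 1 xq)
      (fun x hx => (hd x hx).continuousAt.continuousWithinAt) fun x hx => ?_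
    rw [interior_Ioo] at hx
    rw [(hd x hx).deriv]
    refine div_neg_of_neg_of_pos ?_ (sq_pos_of_neg (hψneg x hx))
    -- `x + 1 / 2` lies beyond the zero, so `-ψ x` is less than the increment over `[x, x + 1 / 2]`.
    have hhalf : 0 < ψ (x + 1 / 2) := hψpos _ (by simp only [mem_Ioi]; linarith [hx.1])
    have := hkey x hx.1
    have := mul_pos hhalf (neg_pos.2 (hneg x (by linarith [hx.1])))
    nlinarith
  refine ⟨xq, ⟨hq1, hq2⟩, fun x hx => ⟨fun h => ?_, fun h => h ▸ hzero⟩, hleft, ?_, ?_, ?_⟩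
  · exact hmono.injOn hx hq0 (h.trans hzero.symm)
  · intro x hx y hy hxy
    have hx0 : x ∈ Ioi (0 : ℝ) := lt_trans (mem_Ioi.1 hq0) hx
    have hy0 : y ∈ Ioi (0 : ℝ) := lt_trans (mem_Ioi.1 hq0) hy
    exact div_lt_div₀ (hanti hx0 hy0 hxy) (hmono hx0 hy0 hxy).le (hpos x hx0).le (hψpos x hx)
  · intro x hx y hy hxy
    have h := hleft hx hy hxy
    have hGx : D₁ x / ψ x < 0 :=
      div_neg_of_pos_of_neg (hpos x (by linarith [hx.1])) (hψneg x hx)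
    simp only at h ⊢
    nlinarith [hx.1]
  · intro x hx y hy hxy
    have hx1 : (1 : ℝ) < x := hq1.trans hx
    have hy1 : (1 : ℝ) < y := hq1.trans hy
    simp only [← mul_div_assoc]
    exact div_lt_div₀ (hxanti hx1 hy1 hxy)
      (hmono (by simp only [mem_Ioi]; linarith) (by simp only [mem_Ioi]; linarith) hxy).le
      (mul_pos (by linarith) (hpos x (by linarith))).le (hψpos x hx)

/-! ### Kernels -/

/-- The properties of `L`, its derivative `ℓ`, and `h = -ℓ'`, `k = -h'` on the positive half-line
from which the behaviour of the logarithmic derivative of `exp (logGammaSeries L)` follows. The last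
field bounds the half-step decrements of `ℓ` and the function `k` by multiples of `h`, with product
of the constants at most `1`. -/
structure IsGammaKernel (L ℓ h k : ℝ → ℝ) : Prop where
  hasDerivAt_L : ∀ y, 0 < y → HasDerivAt L (ℓ y) y
  hasDerivAt_ℓ : ∀ y, 0 < y → HasDerivAt ℓ (-h y) y
  hasDerivAt_h : ∀ y, 0 < y → HasDerivAt h (-k y) y
  ℓ_pos : ∀ y, 0 < y → 0 < ℓ y
  h_pos : ∀ y, 0 < y → 0 < h y
  k_pos : ∀ y, 0 < y → 0 < k y
  k_anti : AntitoneOn k (Ioi 0)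
  two_mul_h_le : ∀ y, 0 < y → 2 * h y ≤ y * k y
  exists_bounds : ∃ a b : ℝ, a * b ≤ 1 ∧ ∀ y, 1 < y →
    ℓ y - ℓ (y + 1 / 2) ≤ a * h y ∧ k y ≤ b * h y

/-- The logarithm of the gamma function with kernel `L`: the limit of
`(x - 1) * L (N + 1) + ∑ n < N, (L (n + 1) - L (n + x))` when `L 1 = 0`, written as a series. -/
noncomputable def logGammaSeries (L : ℝ → ℝ) (x : ℝ) : ℝ :=
  ∑' n : ℕ, ((x - 1) * (L (n + 2) - L (n + 1)) + (L (n + 1) - L (n + x)))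

/-- The termwise derivative of `logGammaSeries L`, where `ℓ` is the derivative of `L`. -/
noncomputable def digammaSeries (L ℓ : ℝ → ℝ) (x : ℝ) : ℝ :=
  ∑' n : ℕ, (L (n + 2) - L (n + 1) - ℓ (n + x))

/-! ### Monotone functions and telescoping sums -/

theorem strictAntiOn_of_hasDerivAt_neg {F f : ℝ → ℝ}
    (hF : ∀ y, 0 < y → HasDerivAt F (-f y) y) (hf : ∀ y, 0 < y → 0 < f y) :
    StrictAntiOn F (Ioi 0) := by
  refine strictAntiOn_of_deriv_neg (convex_Ioi 0)
    (fun x hx => (hF x hx).continuousAt.continuousWithinAt) fun x hx => ?_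
  rw [interior_Ioi] at hx
  rw [(hF x hx).deriv]
  exact neg_neg_of_pos (hf x hx)

theorem exists_mem_Ioo_sub_eq {F f : ℝ → ℝ} (hF : ∀ y, 0 < y → HasDerivAt F (f y) y)
    {a b : ℝ} (ha : 0 < a) (hab : a < b) : ∃ c ∈ Ioo a b, F b - F a = f c * (b - a) := by
  obtain ⟨c, hc, h⟩ := exists_hasDerivAt_eq_slope F f hab
    (fun y hy => (hF y (ha.trans_le hy.1)).continuousAt.continuousWithinAt)
    fun y hy => hF y (ha.trans hy.1)
  exact ⟨c, hc, by rw [h, div_mul_cancel₀ _ (sub_pos.2 hab).ne']⟩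

/-- The values of `f` along `x, x + 1, …` are dominated by the telescoping decrements of `F`. -/
theorem summable_nat_add_of_hasDerivAt_neg {F f : ℝ → ℝ}
    (hF : ∀ y, 0 < y → HasDerivAt F (-f y) y) (hF0 : ∀ y, 0 < y → 0 < F y)
    (hf : ∀ y, 0 < y → 0 < f y) (hanti : AntitoneOn f (Ioi 0)) {x : ℝ} (hx : 0 < x) :
    Summable fun n : ℕ => f (n + x) := by
  rw [← summable_nat_add_iff 1]
  refine summable_of_sum_range_le (c := F x) (fun n => (hf _ (by positivity)).le) fun N => ?_
  have hstep : ∀ n : ℕ, f ((n + 1 : ℕ) + x) ≤ F (n + x) - F ((n + 1 : ℕ) + x) := fun n => by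
    have hn : (0 : ℝ) < n + x := by positivity
    obtain ⟨c, hc, h⟩ := exists_mem_Ioo_sub_eq (f := fun y => -f y) hF hn (lt_add_one _)
    have := hanti (hn.trans hc.1) (hn.trans (lt_add_one _)) hc.2.le
    push_cast
    rw [show (n : ℝ) + 1 + x = n + x + 1 by ring]
    linarith
  calc ∑ n ∈ Finset.range N, f ((n + 1 : ℕ) + x)
      ≤ ∑ n ∈ Finset.range N, (F (n + x) - F ((n + 1 : ℕ) + x)) :=
        Finset.sum_le_sum fun n _ => hstep n
    _ = F x - F (N + x) := by
        rw [Finset.sum_range_sub' (fun n : ℕ => F (n + x))]; simp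
    _ ≤ F x := by have := hF0 (N + x) (by positivity); linarith

theorem hasDerivAt_comp_nat_add {F f : ℝ → ℝ} (hF : ∀ y, 0 < y → HasDerivAt F (f y) y)
    (n : ℕ) {x : ℝ} (hx : 0 < x) : HasDerivAt (fun z => F (n + z)) (f (n + x)) x :=
  (hF (n + x) (by positivity)).comp_const_add (n : ℝ) x

/-- This sum is the derivative of `x * ∑ 1 / (n + x) ^ 2`; its sign is thus the monotonicity of
`x * ψ' x` for `q = 1`. -/
theorem tsum_sub_two_mul_div_cube_neg {x : ℝ} (hx : 1 < x)
    (hs : Summable fun n : ℕ => (n + x - 2 * x) / (n + x) ^ 3) :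
    ∑' n : ℕ, (n + x - 2 * x) / (n + x) ^ 3 < 0 := by
  -- The midpoint bound for `∑ 1 / y ^ 2` minus the trapezoidal bound for `x * ∑ 2 / y ^ 3`.
  let T : ℝ → ℝ := fun y => 1 / (y - 1 / 2) - x * (1 / y ^ 2 + 1 / y ^ 3)
  have hT : T x < 0 := by
    have h1 : 0 < x - 1 / 2 := by linarith
    have h2 : 1 / (x - 1 / 2) < (x + 1) / x ^ 2 := by
      rw [div_lt_div_iff₀ h1 (by positivity)]
      nlinarith
    have h3 : x * (1 / x ^ 2 + 1 / x ^ 3) = (x + 1) / x ^ 2 := by field_simp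
    simp only [T]
    linarith
  have hstep : ∀ y : ℝ, 1 < y → (y - 2 * x) / y ^ 3 ≤ T y - T (y + 1) := fun y hy => by
    have h1 : 0 < y - 1 / 2 := by linarith
    have h2 : 1 / y ^ 2 ≤ 1 / (y - 1 / 2) - 1 / (y + 1 - 1 / 2) := by
      have h3 : 0 < y + 1 - 1 / 2 := by linarith
      rw [div_sub_div _ _ h1.ne' h3.ne', div_le_div_iff₀ (by positivity) (by positivity)]
      nlinarith
    have h3 : (1 / y ^ 2 + 1 / y ^ 3) - (1 / (y + 1) ^ 2 + 1 / (y + 1) ^ 3) ≤ 2 / y ^ 3 := by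
      have : 2 / y ^ 3 - ((1 / y ^ 2 + 1 / y ^ 3) - (1 / (y + 1) ^ 2 + 1 / (y + 1) ^ 3))
          = (2 * y + 1) / (y ^ 3 * (y + 1) ^ 3) := by field_simp; ring
      have : 0 ≤ (2 * y + 1) / (y ^ 3 * (y + 1) ^ 3) := by positivity
      linarith
    have h4 : (y - 2 * x) / y ^ 3 = 1 / y ^ 2 - x * (2 / y ^ 3) := by field_simp
    have h5 := mul_le_mul_of_nonneg_left h3 (by linarith : 0 ≤ x)
    simp only [T]
    linarith
  have hlim : Tendsto (fun N : ℕ => T x - T (N + x)) atTop (𝓝 (T x - 0)) := by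
    have hN : Tendsto (fun N : ℕ => (N : ℝ) + x) atTop atTop :=
      tendsto_atTop_add_const_right _ _ tendsto_natCast_atTop_atTop
    have ha : Tendsto (fun y : ℝ => 1 / (y - 1 / 2)) atTop (𝓝 0) := by
      simp only [one_div, sub_eq_add_neg]
      exact (tendsto_atTop_add_const_right atTop _ tendsto_id).inv_tendsto_atTop
    have hp : ∀ m : ℕ, m ≠ 0 → Tendsto (fun y : ℝ => 1 / y ^ m) atTop (𝓝 0) := fun m hm => by
      simp only [one_div]
      exact (tendsto_pow_atTop (α := ℝ) hm).inv_tendsto_atTop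
    have hT0 : Tendsto T atTop (𝓝 0) := by
      simpa [T] using ha.sub (((hp 2 two_ne_zero).add (hp 3 three_ne_zero)).const_mul x)
    exact tendsto_const_nhds.sub (hT0.comp hN)
  have := le_of_tendsto_of_tendsto' hs.hasSum.tendsto_sum_nat hlim fun N => by
    calc ∑ n ∈ Finset.range N, ((n : ℝ) + x - 2 * x) / (n + x) ^ 3
        ≤ ∑ n ∈ Finset.range N, (T (n + x) - T ((n + 1 : ℕ) + x)) :=
          Finset.sum_le_sum fun n _ => by
            have h := hstep (n + x) (by have := n.cast_nonneg (α := ℝ); linarith)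
            rwa [show (n : ℝ) + x + 1 = (n + 1 : ℕ) + x by push_cast; ring] at h
      _ = T x - T (N + x) := by
          rw [Finset.sum_range_sub' (fun n : ℕ => T (n + x))]; simp
  linarith

/-! ### The digamma series of a kernel -/

namespace IsGammaKernel

variable {L ℓ h k : ℝ → ℝ} (H : IsGammaKernel L ℓ h k)
include H

theorem h_strictAnti : StrictAntiOn h (Ioi 0) :=
  strictAntiOn_of_hasDerivAt_neg H.hasDerivAt_h H.k_pos

theorem ℓ_strictAnti : StrictAntiOn ℓ (Ioi 0) :=
  strictAntiOn_of_hasDerivAt_neg H.hasDerivAt_ℓ H.h_pos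

theorem summable_h {x : ℝ} (hx : 0 < x) : Summable fun n : ℕ => h (n + x) :=
  summable_nat_add_of_hasDerivAt_neg H.hasDerivAt_ℓ H.ℓ_pos H.h_pos H.h_strictAnti.antitoneOn hx

theorem summable_k {x : ℝ} (hx : 0 < x) : Summable fun n : ℕ => k (n + x) :=
  summable_nat_add_of_hasDerivAt_neg H.hasDerivAt_h H.h_pos H.k_pos H.k_anti hx


theorem sub_sub_ℓ_mem {y : ℝ} (hy : 0 < y) : L (y + 1) - L y - ℓ y ∈ Ioo (-h y) 0 := by
  obtain ⟨c, hc, hLc⟩ := exists_mem_Ioo_sub_eq H.hasDerivAt_L hy (lt_add_one y)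
  obtain ⟨d, hd, hℓd⟩ := exists_mem_Ioo_sub_eq H.hasDerivAt_ℓ hy hc.1
  have hc1 : c - y < 1 := by linarith [hc.2]
  have h1 := H.ℓ_strictAnti hy (hy.trans hc.1) hc.1
  have h2 := H.h_strictAnti hy (hy.trans hd.1) hd.1
  have h3 := H.h_pos d (hy.trans hd.1)
  simp only [add_sub_cancel_left, mul_one] at hLc
  rw [hLc]
  exact ⟨by nlinarith, by linarith⟩

/-- The midpoint rule underestimates the integral of the strictly convex function `ℓ`. -/
theorem ℓ_lt_sub {y : ℝ} (hy : 1 / 2 < y) : ℓ y < L (y + 1 / 2) - L (y - 1 / 2) := by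
  let g : ℝ → ℝ := fun d => L (y + d) - L (y - d) - 2 * d * ℓ y
  have hg : ∀ d ∈ Icc (0 : ℝ) (1 / 2),
      HasDerivAt g (ℓ (y + d) + ℓ (y - d) - 2 * ℓ y) d := fun d hd => by
    have h1 := (H.hasDerivAt_L (y + d) (by linarith [hd.1])).comp_const_add y d
    have h2 := (H.hasDerivAt_L (y - d) (by linarith [hd.2])).comp_const_sub y d
    have h3 := ((hasDerivAt_id d).const_mul 2).mul_const (ℓ y)
    convert! (h1.sub h2).sub h3 using 1
    ring
  have hmono : StrictMonoOn g (Icc 0 (1 / 2)) := by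
    refine strictMonoOn_of_deriv_pos (convex_Icc _ _)
      (fun d hd => (hg d hd).continuousAt.continuousWithinAt) fun d hd => ?_
    rw [interior_Icc] at hd
    rw [(hg d (Ioo_subset_Icc_self hd)).deriv]
    obtain ⟨hd0, hd1⟩ := hd
    have hyd : 0 < y - d := by linarith
    have hy0 : 0 < y := by linarith
    obtain ⟨c, hc, h1⟩ :=
      exists_mem_Ioo_sub_eq H.hasDerivAt_ℓ hyd (by linarith : y - d < y)
    obtain ⟨e, he, h2⟩ :=
      exists_mem_Ioo_sub_eq H.hasDerivAt_ℓ hy0 (by linarith : y < y + d)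
    have h3 := H.h_strictAnti (hyd.trans hc.1) (hy0.trans he.1) (hc.2.trans he.1)
    nlinarith
  have := hmono (by norm_num) (by norm_num) (by norm_num : (0 : ℝ) < 1 / 2)
  simp only [g, add_zero, sub_zero, sub_self, mul_zero, zero_mul] at this
  linarith

theorem summable_digamma_one : Summable fun n : ℕ => L (n + 2) - L (n + 1) - ℓ (n + 1) := by
  refine Summable.of_norm_bounded (H.summable_h one_pos) fun n => ?_
  obtain ⟨h1, h2⟩ := H.sub_sub_ℓ_mem (y := n + 1) (by positivity)
  rw [show (n : ℝ) + 1 + 1 = n + 2 by ring] at h1 h2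
  rw [Real.norm_eq_abs, abs_le]
  exact ⟨h1.le, by linarith [H.h_pos (n + 1) (by positivity)]⟩

theorem hasDerivAt_digamma_term (n : ℕ) {x : ℝ} (hx : 0 < x) :
    HasDerivAt (fun x => L (n + 2) - L (n + 1) - ℓ (n + x)) (h (n + x)) x := by
  simpa using (hasDerivAt_comp_nat_add H.hasDerivAt_ℓ n hx).const_sub (L (n + 2) - L (n + 1))

theorem norm_h_le {a y : ℝ} (ha : 0 < a) (hy : a < y) (n : ℕ) : ‖h (n + y)‖ ≤ h (n + a) := by
  have hy0 : 0 < n + y := by have := ha.trans hy; positivity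
  have hna : 0 < n + a := by positivity
  rw [Real.norm_of_nonneg (H.h_pos _ hy0).le]
  exact H.h_strictAnti.antitoneOn hna hy0 (by linarith)

theorem summable_digamma {x : ℝ} (hx : 0 < x) :
    Summable fun n : ℕ => L (n + 2) - L (n + 1) - ℓ (n + x) := by
  obtain ⟨a, ha, hax⟩ := exists_between (lt_min hx one_pos)
  exact summable_of_summable_hasDerivAt_of_isPreconnected
    (g := fun (n : ℕ) x => L (n + 2) - L (n + 1) - ℓ (n + x)) (H.summable_h ha) isOpen_Ioi
    isPreconnected_Ioi (fun n y hy => H.hasDerivAt_digamma_term n (ha.trans hy))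
    (fun n y hy => H.norm_h_le ha hy n) (lt_min_iff.1 hax).2 H.summable_digamma_one
    (lt_min_iff.1 hax).1

theorem hasDerivAt_digammaSeries {x : ℝ} (hx : 0 < x) :
    HasDerivAt (digammaSeries L ℓ) (∑' n : ℕ, h (n + x)) x := by
  obtain ⟨a, ha, hax⟩ := exists_between hx
  exact hasDerivAt_tsum_of_isPreconnected
    (g := fun (n : ℕ) x => L (n + 2) - L (n + 1) - ℓ (n + x)) (H.summable_h ha) isOpen_Ioi
    isPreconnected_Ioi (fun n y hy => H.hasDerivAt_digamma_term n (ha.trans hy))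
    (fun n y hy => H.norm_h_le ha hy n) hax (H.summable_digamma hx) hax

theorem hasDerivAt_tsum_h {x : ℝ} (hx : 0 < x) :
    HasDerivAt (fun x => ∑' n : ℕ, h (n + x)) (-∑' n : ℕ, k (n + x)) x := by
  obtain ⟨a, ha, hax⟩ := exists_between hx
  rw [← tsum_neg]
  refine hasDerivAt_tsum_of_isPreconnected (g := fun (n : ℕ) x => h (n + x))
    (g' := fun (n : ℕ) x => -k (n + x)) (H.summable_k ha) isOpen_Ioi isPreconnected_Ioi
    (fun n y hy => hasDerivAt_comp_nat_add H.hasDerivAt_h n (ha.trans hy)) (fun n y hy => ?_) hax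
    (H.summable_h hx) hax
  have hy0 : 0 < n + y := by have := ha.trans hy; positivity
  have hna : 0 < n + a := by positivity
  rw [norm_neg, Real.norm_of_nonneg (H.k_pos _ hy0).le]
  exact H.k_anti hna hy0 (by linarith [mem_Ioi.1 hy])

theorem summable_logGamma_and_hasDerivAt {x : ℝ} (hx : 0 < x) :
    (Summable fun n : ℕ => (x - 1) * (L (n + 2) - L (n + 1)) + (L (n + 1) - L (n + x))) ∧
      HasDerivAt (logGammaSeries L) (digammaSeries L ℓ x) x := by
  obtain ⟨a, ha, hax⟩ := exists_between (lt_min hx one_pos)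
  obtain ⟨b, hb⟩ := exists_gt (max x 1)
  obtain ⟨hax, ha1⟩ := lt_min_iff.1 hax
  obtain ⟨hxb, hb1⟩ := max_lt_iff.1 hb
  have hu := (H.summable_digamma ha).abs.add (H.summable_digamma (hx.trans hxb)).abs
  have hd : ∀ (n : ℕ), ∀ y ∈ Ioo a b, HasDerivAt
      (fun y => (y - 1) * (L (n + 2) - L (n + 1)) + (L (n + 1) - L (n + y)))
      (L (n + 2) - L (n + 1) - ℓ (n + y)) y := fun n y hy => by
    have h1 := ((hasDerivAt_id y).sub_const 1).mul_const (L (n + 2) - L (n + 1))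
    have h2 := (hasDerivAt_comp_nat_add H.hasDerivAt_L n (ha.trans hy.1)).const_sub (L (n + 1))
    convert! h1.add h2 using 1
    ring
  have hbound : ∀ (n : ℕ), ∀ y ∈ Ioo a b, ‖L (n + 2) - L (n + 1) - ℓ (n + y)‖ ≤
      |L (n + 2) - L (n + 1) - ℓ (n + a)| + |L (n + 2) - L (n + 1) - ℓ (n + b)| := fun n y hy => by
    have hna : 0 < n + a := by positivity
    have hny : n + a < n + y := by linarith [hy.1]
    have hnb : n + y < n + b := by linarith [hy.2]
    have h1 := H.ℓ_strictAnti hna (hna.trans hny) hny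
    have h2 := H.ℓ_strictAnti (hna.trans hny) (hna.trans (hny.trans hnb)) hnb
    -- The term is increasing in `y`, hence lies between its values at `a` and at `b`.
    rw [Real.norm_eq_abs, abs_le]
    constructor
    · have := neg_abs_le (L (n + 2) - L (n + 1) - ℓ (n + a))
      have := abs_nonneg (L (n + 2) - L (n + 1) - ℓ (n + b))
      linarith
    · have := le_abs_self (L (n + 2) - L (n + 1) - ℓ (n + b))
      have := abs_nonneg (L (n + 2) - L (n + 1) - ℓ (n + a))
      linarith
  -- At the point `1` every term of the series vanishes.
  have h1 : Summable fun n : ℕ =>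
      ((1 : ℝ) - 1) * (L (n + 2) - L (n + 1)) + (L (n + 1) - L (n + 1)) := by
    simp
  exact ⟨summable_of_summable_hasDerivAt_of_isPreconnected
      (g := fun (n : ℕ) y => (y - 1) * (L (n + 2) - L (n + 1)) + (L (n + 1) - L (n + y)))
      hu isOpen_Ioo isPreconnected_Ioo hd hbound ⟨ha1, hb1⟩ h1 ⟨hax, hxb⟩,
    hasDerivAt_tsum_of_isPreconnected
      (g := fun (n : ℕ) y => (y - 1) * (L (n + 2) - L (n + 1)) + (L (n + 1) - L (n + y)))
      hu isOpen_Ioo isPreconnected_Ioo hd hbound ⟨ha1, hb1⟩ h1 ⟨hax, hxb⟩⟩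

theorem digammaSeries_one_neg : digammaSeries L ℓ 1 < 0 := by
  have hterm : ∀ n : ℕ, L (n + 2) - L (n + 1) - ℓ (n + 1) < 0 := fun n => by
    have := (H.sub_sub_ℓ_mem (y := n + 1) (by positivity)).2
    rwa [show (n : ℝ) + 1 + 1 = n + 2 by ring] at this
  have := H.summable_digamma_one.neg.tsum_pos (fun n => (neg_pos.2 (hterm n)).le) 0
    (neg_pos.2 (hterm 0))
  rw [tsum_neg] at this
  exact neg_pos.1 this

theorem digammaSeries_three_halves_pos : 0 < digammaSeries L ℓ (3 / 2) := by
  have hterm : ∀ n : ℕ, 0 < L (n + 2) - L (n + 1) - ℓ (n + 3 / 2) := fun n => by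
    have := H.ℓ_lt_sub (y := n + 3 / 2) (by linarith [n.cast_nonneg (α := ℝ)])
    rw [show (n : ℝ) + 3 / 2 + 1 / 2 = n + 2 by ring,
      show (n : ℝ) + 3 / 2 - 1 / 2 = n + 1 by ring] at this
    linarith
  exact (H.summable_digamma (by norm_num)).tsum_pos (fun n => (hterm n).le) 0 (hterm 0)

theorem tsum_h_pos {x : ℝ} (hx : 0 < x) : 0 < ∑' n : ℕ, h (n + x) :=
  (H.summable_h hx).tsum_pos (fun n => (H.h_pos _ (by positivity)).le) 0
    (H.h_pos _ (by positivity))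

theorem tsum_k_pos {x : ℝ} (hx : 0 < x) : 0 < ∑' n : ℕ, k (n + x) :=
  (H.summable_k hx).tsum_pos (fun n => (H.k_pos _ (by positivity)).le) 0
    (H.k_pos _ (by positivity))

/-! ### The two inequalities for the digamma series -/

theorem antitoneOn_sq_mul_h : AntitoneOn (fun y => y ^ 2 * h y) (Ioi 0) := by
  have hd : ∀ y : ℝ, 0 < y → HasDerivAt (fun y => y ^ 2 * h y) (y * (2 * h y - y * k y)) y :=
    fun y hy => by
      convert! (hasDerivAt_pow 2 y).mul (H.hasDerivAt_h y hy) using 1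
      push_cast
      ring
  refine antitoneOn_of_deriv_nonpos (convex_Ioi 0)
    (fun y hy => (hd y hy).continuousAt.continuousWithinAt)
    (fun y hy => (hd y (by simpa using hy)).differentiableAt.differentiableWithinAt) fun y hy => ?_
  rw [interior_Ioi] at hy
  rw [(hd y hy).deriv]
  exact mul_nonpos_of_nonneg_of_nonpos (le_of_lt hy) (by linarith [H.two_mul_h_le y hy])

/-- The left-hand side is the derivative of `x * ψ' x`. -/
theorem tsum_h_sub_mul_tsum_k_neg {x : ℝ} (hx : 1 < x) :
    ∑' n : ℕ, h (n + x) + x * (-∑' n : ℕ, k (n + x)) < 0 := by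
  have hx0 : 0 < x := by linarith
  have h2x := H.h_pos (2 * x) (by linarith)
  have hs : Summable fun n : ℕ => ((n : ℝ) + x - 2 * x) / (n + x) ^ 3 := by
    have hp : Summable fun n : ℕ => 1 / ((n : ℝ) + x) ^ 2 := by
      simpa using (Real.summable_one_div_nat_add_rpow x 2).2 one_lt_two
    refine Summable.of_norm_bounded hp fun n => ?_
    have hn : (0 : ℝ) < n + x := by positivity
    rw [Real.norm_eq_abs, abs_div, abs_of_pos (pow_pos hn 3), div_le_div_iff₀ (by positivity)
      (by positivity), one_mul, pow_succ' _ 2]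
    refine mul_le_mul_of_nonneg_right (abs_le.2 ⟨?_, ?_⟩) (by positivity) <;>
      linarith [n.cast_nonneg (α := ℝ)]
  have hle : ∀ n : ℕ, h (n + x) - x * k (n + x) ≤
      (2 * x) ^ 2 * h (2 * x) * ((n + x - 2 * x) / (n + x) ^ 3) := fun n => by
    have hn : (0 : ℝ) < n + x := by positivity
    set y : ℝ := n + x
    have h1 : h y - x * k y ≤ y ^ 2 * h y * ((y - 2 * x) / y ^ 3) := by
      have h2 : y ^ 2 * h y * ((y - 2 * x) / y ^ 3) = h y - x * (2 * h y / y) := by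
        field_simp
      have h3 : 2 * h y / y ≤ k y := by
        rw [div_le_iff₀ hn, mul_comm (k y)]
        exact H.two_mul_h_le y hn
      rw [h2]
      linarith [mul_le_mul_of_nonneg_left h3 hx0.le]
    refine h1.trans ?_
    -- The weight `y ^ 2 * h y` is antitone and the other factor changes sign at `y = 2 * x`.
    have h2x' : (0 : ℝ) < 2 * x := by linarith
    rcases le_total y (2 * x) with hy | hy
    · exact mul_le_mul_of_nonpos_right (H.antitoneOn_sq_mul_h hn h2x' hy)
        (div_nonpos_of_nonpos_of_nonneg (by linarith) (by positivity))
    · exact mul_le_mul_of_nonneg_right (H.antitoneOn_sq_mul_h h2x' hn hy)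
        (div_nonneg (by linarith) (by positivity))
  have hsum := ((H.summable_h hx0).sub ((H.summable_k hx0).mul_left x)).tsum_le_tsum hle
    (hs.mul_left _)
  rw [(H.summable_h hx0).tsum_sub ((H.summable_k hx0).mul_left x), tsum_mul_left,
    tsum_mul_left] at hsum
  have := mul_neg_of_pos_of_neg (by positivity : 0 < (2 * x) ^ 2 * h (2 * x))
    (tsum_sub_two_mul_div_cube_neg hx hs)
  linarith

/-- `(ψ (x + 1 / 2) - ψ x) * (-ψ'' x) ≤ ψ' x ^ 2`: the increment is at most `a * ψ' x` and `-ψ'' x`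
is at most `b * ψ' x`, where `a * b ≤ 1`. -/
theorem digammaSeries_increment_mul_le {x : ℝ} (hx : 1 < x) :
    (digammaSeries L ℓ (x + 1 / 2) - digammaSeries L ℓ x) * (- -∑' n : ℕ, k (n + x)) ≤
      (∑' n : ℕ, h (n + x)) ^ 2 := by
  have hx0 : 0 < x := by linarith
  obtain ⟨a, b, hab, hbd⟩ := H.exists_bounds
  have hlt : ∀ n : ℕ, 1 < (n : ℝ) + x := fun n => by linarith [n.cast_nonneg (α := ℝ)]
  have hs1 := H.summable_digamma (x := x + 1 / 2) (by linarith)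
  have hs2 := H.summable_digamma hx0
  have hA : digammaSeries L ℓ (x + 1 / 2) - digammaSeries L ℓ x ≤ a * ∑' n : ℕ, h (n + x) := by
    rw [digammaSeries, digammaSeries, ← hs1.tsum_sub hs2, ← tsum_mul_left]
    refine (hs1.sub hs2).tsum_le_tsum (fun n => ?_) ((H.summable_h hx0).mul_left a)
    have := (hbd _ (hlt n)).1
    rw [show (n : ℝ) + x + 1 / 2 = n + (x + 1 / 2) by ring] at this
    linarith
  have hA0 : 0 ≤ digammaSeries L ℓ (x + 1 / 2) - digammaSeries L ℓ x := by
    rw [digammaSeries, digammaSeries, ← hs1.tsum_sub hs2]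
    refine tsum_nonneg fun n => ?_
    have hn : (0 : ℝ) < n + x := by positivity
    have := H.ℓ_strictAnti (a := n + x) (b := n + (x + 1 / 2)) hn (mem_Ioi.2 (by linarith))
      (by linarith)
    linarith
  have hK : ∑' n : ℕ, k (n + x) ≤ b * ∑' n : ℕ, h (n + x) := by
    rw [← tsum_mul_left]
    exact (H.summable_k hx0).tsum_le_tsum (fun n => (hbd _ (hlt n)).2)
      ((H.summable_h hx0).mul_left b)
  have hK0 := H.tsum_k_pos hx0
  rw [neg_neg]
  calc _ ≤ (a * ∑' n : ℕ, h (n + x)) * (b * ∑' n : ℕ, h (n + x)) :=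
        mul_le_mul hA hK hK0.le (hA0.trans hA)
    _ = a * b * (∑' n : ℕ, h (n + x)) ^ 2 := by ring
    _ ≤ _ := mul_le_of_le_one_left (sq_nonneg _) hab

theorem exists_zero_and_strictAntiOn_logDeriv {Γ : ℝ → ℝ}
    (hΓ : ∀ x, 0 < x → Γ x = Real.exp (logGammaSeries L x)) :
    ∃ xq ∈ Ioo (1 : ℝ) (3 / 2),
      (∀ x : ℝ, 0 < x → (logDeriv Γ x = 0 ↔ x = xq)) ∧
      StrictAntiOn (fun x : ℝ => deriv (logDeriv Γ) x / logDeriv Γ x) (Ioo 1 xq) ∧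
      StrictAntiOn (fun x : ℝ => deriv (logDeriv Γ) x / logDeriv Γ x) (Ioi xq) ∧
      StrictAntiOn (fun x : ℝ => x * (deriv (logDeriv Γ) x / logDeriv Γ x)) (Ioo 1 xq) ∧
      StrictAntiOn (fun x : ℝ => x * (deriv (logDeriv Γ) x / logDeriv Γ x)) (Ioi xq) := by
  have hψ : EqOn (logDeriv Γ) (digammaSeries L ℓ) (Ioi 0) := fun x hx => by
    have h1 : Γ =ᶠ[𝓝 x] fun x => Real.exp (logGammaSeries L x) :=
      eventuallyEq_of_mem (Ioi_mem_nhds hx) hΓ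
    rw [logDeriv_apply, h1.deriv_eq, (H.summable_logGamma_and_hasDerivAt hx).2.exp.deriv, hΓ x hx,
      mul_div_cancel_left₀ _ (Real.exp_ne_zero _)]
  have hD : EqOn (deriv (logDeriv Γ)) (fun x => ∑' n : ℕ, h (n + x)) (Ioi 0) := fun x hx =>
    (eventuallyEq_of_mem (Ioi_mem_nhds hx) hψ).deriv_eq.trans (H.hasDerivAt_digammaSeries hx).deriv
  obtain ⟨xq, hxq, hzero, h1, h2, h3, h4⟩ := exists_zero_and_strictAntiOn
    (fun x hx => H.hasDerivAt_digammaSeries hx) (fun x hx => H.hasDerivAt_tsum_h hx)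
    (fun x hx => H.tsum_h_pos hx) (fun x hx => neg_neg_of_pos (H.tsum_k_pos hx))
    (fun x hx => H.tsum_h_sub_mul_tsum_k_neg hx) H.digammaSeries_one_neg
    H.digammaSeries_three_halves_pos fun x hx => H.digammaSeries_increment_mul_le hx
  have hIoo : Ioo 1 xq ⊆ Ioi 0 := fun x hx => one_pos.trans hx.1
  have hIoi : Ioi xq ⊆ Ioi 0 := fun x hx => one_pos.trans (hxq.1.trans hx)
  refine ⟨xq, hxq, fun x hx => by rw [hψ hx, hzero x hx], h1.congr fun x hx => ?_,
    h2.congr fun x hx => ?_, h3.congr fun x hx => ?_, h4.congr fun x hx => ?_⟩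
  all_goals first
    | simp only [hψ (hIoo hx), hD (hIoo hx)]
    | simp only [hψ (hIoi hx), hD (hIoi hx)]

end IsGammaKernel

/-! ### The kernels of `Γ` and `Γ_q` -/

theorem isGammaKernel_log :
    IsGammaKernel Real.log (fun y => y⁻¹) (fun y => (y ^ 2)⁻¹) (fun y => 2 / y ^ 3) where
  hasDerivAt_L y hy := Real.hasDerivAt_log hy.ne'
  hasDerivAt_ℓ y hy := hasDerivAt_inv hy.ne'
  hasDerivAt_h y hy := by
    convert! (hasDerivAt_pow 2 y).inv (by positivity) using 1
    field_simp
    push_cast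
    ring
  ℓ_pos y hy := by positivity
  h_pos y hy := by positivity
  k_pos y hy := by positivity
  k_anti y hy z _ hyz := by
    have : (0 : ℝ) < y := hy
    simp only
    gcongr
  two_mul_h_le y hy := le_of_eq (by field_simp)
  exists_bounds := by
    refine ⟨1 / 2, 2, by norm_num, fun y hy => ⟨?_, ?_⟩⟩
    · have : y⁻¹ - (y + 1 / 2)⁻¹ = 1 / 2 * (y * (y + 1 / 2))⁻¹ := by field_simp; ring
      rw [this]
      gcongr
      nlinarith
    · rw [← div_eq_mul_inv]
      exact div_le_div_of_nonneg_left zero_le_two (by positivity)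
        (pow_le_pow_right₀ hy.le (by norm_num))

theorem isGammaKernel_log_one_sub_rpow {q : ℝ} (hq0 : 0 < q) (hq1 : q < 1) :
    IsGammaKernel (fun y => Real.log (1 - q ^ y) - Real.log (1 - q))
      (fun y => -Real.log q * (q ^ y / (1 - q ^ y)))
      (fun y => Real.log q ^ 2 * (q ^ y / (1 - q ^ y) ^ 2))
      (fun y => -Real.log q ^ 3 * (q ^ y * (1 + q ^ y) / (1 - q ^ y) ^ 3)) := by
  have ht : Real.log q < 0 := Real.log_neg hq0 hq1
  have hv0 : ∀ y : ℝ, 0 < q ^ y := fun y => Real.rpow_pos_of_pos hq0 y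
  have hv1 : ∀ y : ℝ, 0 < y → 0 < 1 - q ^ y := fun y hy =>
    sub_pos.2 (Real.rpow_lt_one hq0.le hq1 hy)
  have hv : ∀ y : ℝ, HasDerivAt (fun y => q ^ y) (Real.log q * q ^ y) y := fun y => by
    simpa using (hasDerivAt_id y).const_rpow hq0
  have ht3 : 0 < -Real.log q ^ 3 := by
    rw [show -Real.log q ^ 3 = (-Real.log q) ^ 3 by ring]
    exact pow_pos (neg_pos.2 ht) 3
  refine ⟨fun y hy => ?_, fun y hy => ?_, fun y hy => ?_, fun y hy => ?_, fun y hy => ?_,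
    fun y hy => ?_, fun y hy z hz hyz => ?_, fun y hy => ?_, ?_⟩
  · have h1 := hv1 y hy
    convert! (((hv y).const_sub 1).log h1.ne').sub_const (Real.log (1 - q)) using 1
    ring
  · have h1 := hv1 y hy
    convert! ((hv y).div ((hv y).const_sub 1) h1.ne').const_mul (-Real.log q) using 1
    field_simp
    ring
  · have h1 := hv1 y hy
    convert! ((hv y).div (((hv y).const_sub 1).pow 2) (pow_pos h1 2).ne').const_mul
      (Real.log q ^ 2) using 1
    simp only [Pi.pow_apply]
    push_cast
    field_simp
    ring
  · exact mul_pos (neg_pos.2 ht) (div_pos (hv0 y) (hv1 y hy))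
  · exact mul_pos (sq_pos_of_neg ht) (div_pos (hv0 y) (pow_pos (hv1 y hy) 2))
  · have := hv0 y
    exact mul_pos ht3 (div_pos (by positivity) (pow_pos (hv1 y hy) 3))
  · have := hv1 y hy
    have := hv0 z
    have : q ^ z ≤ q ^ y := Real.rpow_le_rpow_of_exponent_ge hq0 hq1.le hyz
    gcongr
  · have h1 := hv1 y hy
    have h0 := hv0 y
    -- With `v = q ^ y`, this is `log (1 / v) ≥ 2 * (1 - v) / (1 + v)`.
    have hlog := Real.le_log_one_add_of_nonneg (x := (1 - q ^ y) / q ^ y) (by positivity)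
    have h2 : 1 + (1 - q ^ y) / q ^ y = (q ^ y)⁻¹ := by field_simp; ring
    have h3 : 2 * ((1 - q ^ y) / q ^ y) / ((1 - q ^ y) / q ^ y + 2)
        = 2 * (1 - q ^ y) / (1 + q ^ y) := by field_simp; ring
    rw [h2, h3, Real.log_inv, Real.log_rpow hq0, div_le_iff₀ (by positivity)] at hlog
    have h4 : y * (-Real.log q ^ 3 * (q ^ y * (1 + q ^ y) / (1 - q ^ y) ^ 3)) =
        Real.log q ^ 2 * q ^ y / (1 - q ^ y) ^ 3 * (-(y * Real.log q) * (1 + q ^ y)) := by ring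
    have h5 : 2 * (Real.log q ^ 2 * (q ^ y / (1 - q ^ y) ^ 2)) =
        Real.log q ^ 2 * q ^ y / (1 - q ^ y) ^ 3 * (2 * (1 - q ^ y)) := by field_simp
    rw [h4, h5]
    gcongr
  · -- In terms of `v = q ^ y` and `s = √q`, `ℓ y - ℓ (y + 1 / 2)` is `(1 - s) / -log q * h y` times
    -- `(1 - v) / (1 - s * v)`, `k y` is `-log q * (1 + v) / (1 - v) * h y`, and `v ≤ q`.
    set s := q ^ (1 / 2 : ℝ) with hs
    have hs0 : 0 < s := hv0 _
    have hs1 : 0 < 1 - s := hv1 _ (by norm_num)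
    have hss : q = s ^ 2 := by
      rw [hs, ← Real.rpow_natCast, ← Real.rpow_mul hq0.le]
      norm_num
    refine ⟨(1 - s) / -Real.log q, -Real.log q * ((1 + q) / (1 - q)), ?_, fun y hy => ?_⟩
    · have h1 : (1 - s) / -Real.log q * (-Real.log q * ((1 + q) / (1 - q))) =
          (1 - s) * ((1 + q) / (1 - q)) := by
        rw [← mul_assoc, div_mul_cancel₀ _ (neg_pos.2 ht).ne']
      rw [h1, ← mul_div_assoc, div_le_one (by linarith)]
      have h2 : 1 - q - (1 - s) * (1 + q) = s * (1 - s) ^ 2 := by rw [hss]; ring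
      have h3 : 0 ≤ s * (1 - s) ^ 2 := by positivity
      linarith
    · have h1 := hv1 y (by linarith)
      have h0 := hv0 y
      have hvq : q ^ y ≤ q := by
        simpa using Real.rpow_le_rpow_of_exponent_ge hq0 hq1.le hy.le
      have hvs : q ^ (y + 1 / 2) = q ^ y * s := by rw [Real.rpow_add hq0]
      have hvs1 : 0 < 1 - q ^ y * s := by nlinarith
      have hq1' : 0 < 1 - q := by linarith
      constructor
      · have h2 : -Real.log q * (q ^ y / (1 - q ^ y)) -
            -Real.log q * (q ^ (y + 1 / 2) / (1 - q ^ (y + 1 / 2))) =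
            -Real.log q * (1 - s) * q ^ y / ((1 - q ^ y) * (1 - q ^ y * s)) := by
          rw [hvs]; field_simp; ring
        have h3 : (1 - s) / -Real.log q * (Real.log q ^ 2 * (q ^ y / (1 - q ^ y) ^ 2)) =
            -Real.log q * (1 - s) * q ^ y / (1 - q ^ y) ^ 2 := by
          field_simp
        rw [h2, h3]
        have := neg_pos.2 ht
        have hle : q ^ y * s ≤ q ^ y := mul_le_of_le_one_right h0.le (by linarith)
        rw [sq (1 - q ^ y)]
        gcongr
      · have h2 : -Real.log q * ((1 + q) / (1 - q)) *
            (Real.log q ^ 2 * (q ^ y / (1 - q ^ y) ^ 2)) =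
            -Real.log q ^ 3 * (q ^ y / (1 - q ^ y) ^ 2 * ((1 + q) / (1 - q))) := by ring
        have h3 : q ^ y * (1 + q ^ y) / (1 - q ^ y) ^ 3 =
            q ^ y / (1 - q ^ y) ^ 2 * ((1 + q ^ y) / (1 - q ^ y)) := by field_simp
        rw [h2, h3]
        gcongr

/-! ### Series for `log Γ` and `log Γ_q` -/

/-- The partial sums differ from those of Euler's limit formula by a null sequence. -/
theorem Gamma_eq_exp_logGammaSeries {x : ℝ} (hx : 0 < x) :
    Real.Gamma x = Real.exp (logGammaSeries Real.log x) := by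
  have hs := (isGammaKernel_log.summable_logGamma_and_hasDerivAt hx).1.hasSum.tendsto_sum_nat
  have hpart : ∀ N : ℕ, ∑ n ∈ Finset.range N, ((x - 1) * (Real.log (n + 2) - Real.log (n + 1)) +
      (Real.log (n + 1) - Real.log (n + x))) = (x - 1) * Real.log (N + 1) +
      Real.log N.factorial - ∑ n ∈ Finset.range N, Real.log (x + n) := fun N => by
    induction N with
    | zero => simp
    | succ N ih =>
      rw [Finset.sum_range_succ, ih, Finset.sum_range_succ, Nat.factorial_succ, Nat.cast_mul,
        Real.log_mul (by positivity) (by positivity), add_comm (N : ℝ) x]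
      push_cast
      rw [show (N : ℝ) + 1 + 1 = N + 2 by ring]
      ring
  have hlim : Tendsto (fun N : ℕ => Real.BohrMollerup.logGammaSeq x N +
      ((x - 1) * (Real.log ((N + 1 : ℕ) + 1) - Real.log (N + 1 : ℕ)) +
        x * (Real.log (N + 1) - Real.log N))) atTop
      (𝓝 (Real.log (Real.Gamma x) + ((x - 1) * 0 + x * 0))) :=
    (Real.BohrMollerup.tendsto_log_gamma hx).add
      ((((tendsto_add_atTop_iff_nat 1).2 Real.tendsto_log_nat_add_one_sub_log).const_mul _).add
        (Real.tendsto_log_nat_add_one_sub_log.const_mul _))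
  have heq : Real.log (Real.Gamma x) = logGammaSeries Real.log x := by
    refine tendsto_nhds_unique ?_ ((tendsto_add_atTop_iff_nat 1).2 hs)
    simp only [mul_zero, add_zero] at hlim
    refine hlim.congr fun N => ?_
    rw [hpart, Real.BohrMollerup.logGammaSeq, Nat.factorial_succ, Nat.cast_mul,
      Real.log_mul (by positivity) (by positivity)]
    push_cast
    ring
  rw [← heq, Real.exp_log (Real.Gamma_pos_of_pos hx)]

theorem tprod_eq_exp_logGammaSeries {q : ℝ} (hq0 : 0 < q) (hq1 : q < 1) {x : ℝ} (hx : 0 < x) :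
    (1 - q) ^ (1 - x) * ∏' n : ℕ, (1 - q ^ (n + 1)) / (1 - q ^ ((n : ℝ) + x)) =
      Real.exp (logGammaSeries (fun y => Real.log (1 - q ^ y) - Real.log (1 - q)) x) := by
  have hK := isGammaKernel_log_one_sub_rpow hq0 hq1
  have hs := (hK.summable_logGamma_and_hasDerivAt hx).1
  set L : ℝ → ℝ := fun y => Real.log (1 - q ^ y) - Real.log (1 - q) with hL
  have hv1 : ∀ y : ℝ, 0 < y → 0 < 1 - q ^ y := fun y hy =>
    sub_pos.2 (Real.rpow_lt_one hq0.le hq1 hy)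
  -- The telescoping part contributes `(x - 1) * (lim L - L 1)`, the logarithm of `(1 - q) ^ (1 - x)`.
  have htel : HasSum (fun n : ℕ => L (n + 2) - L (n + 1)) (-Real.log (1 - q)) := by
    rw [hasSum_iff_tendsto_nat_of_nonneg]
    · have hsum : ∀ N : ℕ, ∑ n ∈ Finset.range N, (L (n + 2) - L (n + 1)) = L ((N : ℝ) + 1) := by
        intro N
        induction N with
        | zero => simp [hL]
        | succ N ih =>
          rw [Finset.sum_range_succ, ih]
          push_cast
          rw [show (N : ℝ) + 1 + 1 = N + 2 by ring]
          ring
      simp only [hsum]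
      have h0 : Tendsto (fun N : ℕ => q ^ ((N : ℝ) + 1)) atTop (𝓝 0) := by
        have := (tendsto_add_atTop_iff_nat 1).2 (tendsto_pow_atTop_nhds_zero_of_lt_one hq0.le hq1)
        refine this.congr fun N => ?_
        rw [← Real.rpow_natCast]
        push_cast
        rfl
      have h1 := ((tendsto_const_nhds (x := (1 : ℝ))).sub h0).log (by norm_num)
      simpa [hL] using h1.sub_const (Real.log (1 - q))
    · intro n
      have hn : (0 : ℝ) < n + 1 := by positivity
      obtain ⟨c, hc, h⟩ := exists_mem_Ioo_sub_eq hK.hasDerivAt_L hn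
        (by linarith : (n : ℝ) + 1 < n + 2)
      rw [h]
      exact mul_nonneg (hK.ℓ_pos c (hn.trans hc.1)).le (by linarith)
  have hf : ∀ n : ℕ, 0 < (1 - q ^ (n + 1)) / (1 - q ^ ((n : ℝ) + x)) := fun n =>
    div_pos (sub_pos.2 (pow_lt_one₀ hq0.le hq1 (by omega))) (hv1 _ (by positivity))
  have hlog : ∀ n : ℕ, Real.log ((1 - q ^ (n + 1)) / (1 - q ^ ((n : ℝ) + x))) =
      L (n + 1) - L (n + x) := fun n => by
    have h1 : q ^ (n + 1) = q ^ ((n : ℝ) + 1) := by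
      rw [← Real.rpow_natCast]
      push_cast
      rfl
    rw [h1, Real.log_div (hv1 _ (by positivity)).ne' (hv1 _ (by positivity)).ne']
    simp only [hL]
    ring
  have hs2 : Summable fun n : ℕ => L (n + 1) - L (n + x) := by
    refine (hs.sub (htel.summable.mul_left (x - 1))).congr fun n => ?_
    simp only [hL]
    ring
  have hexp : Real.exp (∑' n : ℕ, (L (n + 1) - L (n + x))) =
      ∏' n : ℕ, (1 - q ^ (n + 1)) / (1 - q ^ ((n : ℝ) + x)) := by
    simp only [← hlog] at hs2 ⊢
    exact Real.rexp_tsum_eq_tprod hf hs2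
  rw [← hexp, logGammaSeries, (htel.summable.mul_left (x - 1)).tsum_add hs2, tsum_mul_left,
    htel.tsum_eq, Real.exp_add, Real.rpow_def_of_pos (by linarith)]
  congr 2
  ring

/-! ### The `q`-digamma function -/

theorem mainTheorem7 (q : ℝ) (hq0 : 0 < q) (hq1 : q ≤ 1) :
    ∃ xq ∈ Ioo (1 : ℝ) (3 / 2),
      (∀ x : ℝ, 0 < x → (qDigamma q x = 0 ↔ x = xq)) ∧
      StrictAntiOn (fun x : ℝ => deriv (qDigamma q) x / qDigamma q x) (Ioo 1 xq) ∧
      StrictAntiOn (fun x : ℝ => deriv (qDigamma q) x / qDigamma q x) (Ioi xq) ∧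
      StrictAntiOn (fun x : ℝ => x * (deriv (qDigamma q) x / qDigamma q x)) (Ioo 1 xq) ∧
      StrictAntiOn (fun x : ℝ => x * (deriv (qDigamma q) x / qDigamma q x)) (Ioi xq) := by
  rcases hq1.lt_or_eq with hq | rfl
  · exact (isGammaKernel_log_one_sub_rpow hq0 hq).exists_zero_and_strictAntiOn_logDeriv
      (Γ := qGamma q) fun x hx => by
        rw [qGamma, if_pos hq, tprod_eq_exp_logGammaSeries hq0 hq hx]
  · exact isGammaKernel_log.exists_zero_and_strictAntiOn_logDeriv (Γ := qGamma 1) fun x hx => by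
      rw [qGamma, if_neg (lt_irrefl _), if_pos rfl, Gamma_eq_exp_logGammaSeries hx]
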